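/- Let $a<b$ and $c<d$ be real numbers, let $\alpha>0$ and $\beta>0$, and let $f:[a,b]\times[c,d]\to\mathbb{R}$ be continuous and of bounded variation in the Arzelà sense, i.e. the sums $\sum_{i=0}^{m-1}|f(x_{i+1},y_{i+1})-f(x_i,y_i)|$, taken over all $m$ and all $a=x_0\le x_1\le\dots\le x_m=b$ and $c=y_0\le y_1\le\dots\le y_m=d$, are bounded. Let $$I^{(\alpha,\beta)}f(x,y)=\frac{1}{\Gamma(\alpha)\Gamma(\beta)}\int_a^x\int_c^y (x-s)^{\alpha-1}(y-t)^{\beta-1}f(s,t)\,\mathrm{d}t\,\mathrm{d}s,\qquad (x,y)\in[a,b]\times[c,d],$$ be its mixed Riemann–Liouville fractional integral, and let $G=\{(x,y,I^{(\alpha,\beta)}f(x,y)):(x,y)\in[a,b]\times[c,d]\}\subseteq\mathbb{R}^3$ be the graph of $I^{(\alpha,\beta)}f$. Then $G$ is nonempty and bounded, its box dimension $\dim_B G=\lim_{\delta\to0^+}\frac{\log N_\delta(G)}{-\log\delta}$ exists, where $N_\delta(G)$ is the smallest number of sets of diameter at most $\delta$ that cover $G$, and $$\dim_B G=\dim_H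 G=2,$$ where $\dim_H$ denotes Hausdorff dimension. -/

import Mathlib

open Set Filter Topology

namespace BivariateVariation

/-- The function `f` on the rectangle `[a,b] × [c,d]` is of bounded variation in the Arzelà sense:
the sums `∑_{i<m} |f(x_{i+1}, y_{i+1}) - f(x_i, y_i)|` over all chains
`a = x_0 ≤ x_1 ≤ ⋯ ≤ x_m = b` and `c = y_0 ≤ y_1 ≤ ⋯ ≤ y_m = d` are bounded.
(Only the values of `f` on the rectangle matter.) -/
def ArzelaBV (a b c d : ℝ) (f : ℝ × ℝ → ℝ) : Prop :=
  ∃ M : ℝ, ∀ (m : ℕ) (x y : ℕ → ℝ),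
    x 0 = a → x m = b → (∀ i < m, x i ≤ x (i + 1)) →
    y 0 = c → y m = d → (∀ i < m, y i ≤ y (i + 1)) →
      ∑ i ∈ Finset.range m, |f (x (i + 1), y (i + 1)) - f (x i, y i)| ≤ M

/-- The mixed Riemann–Liouville fractional integral of order `(α, β)` with base point `(a, c)`:
`(1 / (Γ(α) Γ(β))) ∫_a^x ∫_c^y (x - s)^(α-1) (y - t)^(β-1) f(s,t) dt ds`. -/
noncomputable def fractionalIntegral (a c α β : ℝ) (f : ℝ × ℝ → ℝ) (p : ℝ × ℝ) : ℝ :=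
  1 / (Real.Gamma α * Real.Gamma β) *
    ∫ s in a..p.1, ∫ t in c..p.2,
      (p.1 - s) ^ (α - 1) * (p.2 - t) ^ (β - 1) * f (s, t)

/-- The graph of `g` over `A ⊆ ℝ²`, as a subset of `ℝ³` with its Euclidean metric. -/
def graphOver (A : Set (ℝ × ℝ)) (g : ℝ × ℝ → ℝ) : Set (EuclideanSpace ℝ (Fin 3)) :=
  (fun p : ℝ × ℝ => !₂[p.1, p.2, g p]) '' A

/-- `N_δ(F)`: the smallest number of sets of diameter at most `δ` that can cover `F`. It is only
used for bounded `F` and `δ > 0`, where such a finite cover exists. -/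
noncomputable def coverNumber {n : ℕ} (F : Set (EuclideanSpace ℝ (Fin n))) (δ : ℝ) : ℕ :=
  sInf {k : ℕ | ∃ U : Fin k → Set (EuclideanSpace ℝ (Fin n)),
    (∀ i, Metric.ediam (U i) ≤ ENNReal.ofReal δ) ∧ F ⊆ ⋃ i, U i}

/-- The set `F ⊆ ℝⁿ` is nonempty and bounded, its box dimension exists and equals `D`, that is,
`log N_δ(F) / (- log δ)` tends to `D` as `δ → 0⁺`. -/
def HasBoxDim {n : ℕ} (F : Set (EuclideanSpace ℝ (Fin n))) (D : ℝ) : Prop :=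
  F.Nonempty ∧ Bornology.IsBounded F ∧
    Tendsto (fun δ : ℝ => Real.log (coverNumber F δ : ℝ) / (- Real.log δ)) (𝓝[>] 0) (𝓝 D)

end BivariateVariation

namespace BivariateVariation

open MeasureTheory

/-! On the rectangle the fractional integral is a constant times the convolution of a fixed
integrable kernel with an extension of `f` to the plane: clamp to the rectangle, then cut off to
zero outside the upper quadrant at `(a, c)`. Translations preserve the order, so averaging
translates keeps the variation along chains bounded (`ChainVariationLE.convolution`). Continuity of
`f` enters only through measurability and boundedness.

Bounded chain variation alone bounds the size of the graph. In an `n × n` grid the cells of one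
diagonal form a chain, and there are at most `2 * n` diagonals, so the oscillations over all cells
sum to `O(n)` (`ChainVariationLE.sum_grid_le`). Slicing the column over each cell at height `1 / n`
gives `O(n²)` boxes of diameter `O(1 / n)`, which bounds both dimensions above by 2. The lower
bounds come from the 1-Lipschitz projection of the graph onto the rectangle, which has positive
area. -/

/-! ### Variation along chains -/

/-- The variation of `g` along every nondecreasing sequence in the plane is at most `M`. -/
def ChainVariationLE (g : ℝ × ℝ → ℝ) (M : ℝ) : Prop :=
  ∀ p : ℕ → ℝ × ℝ, Monotone p → ∀ m : ℕ,
    ∑ i ∈ Finset.range m, |g (p (i + 1)) - g (p i)| ≤ M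

/-- The nearest-point retraction of the plane onto the rectangle `[A, B]`. -/
def clamp (A B p : ℝ × ℝ) : ℝ × ℝ := A ⊔ (B ⊓ p)

theorem clamp_mem {A B : ℝ × ℝ} (h : A ≤ B) (p : ℝ × ℝ) : clamp A B p ∈ Icc A B :=
  ⟨le_sup_left, sup_le h inf_le_left⟩

theorem clamp_of_mem {A B p : ℝ × ℝ} (h : p ∈ Icc A B) : clamp A B p = p := by
  rw [clamp, inf_eq_right.2 h.2, sup_eq_right.2 h.1]

theorem clamp_monotone (A B : ℝ × ℝ) : Monotone (clamp A B) :=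
  fun _ _ h => sup_le_sup_left (inf_le_inf_left _ h) _

theorem continuous_clamp (A B : ℝ × ℝ) : Continuous (clamp A B) :=
  Continuous.prodMk (continuous_const.max (continuous_const.min continuous_fst))
    (continuous_const.max (continuous_const.min continuous_snd))

/-- Arzelà variation bounds the variation of the clamped function along all sequences. -/
theorem ArzelaBV.chainVariationLE {a b c d : ℝ} (hab : a ≤ b) (hcd : c ≤ d) {f : ℝ × ℝ → ℝ}
    (h : ArzelaBV a b c d f) : ∃ M, ChainVariationLE (f ∘ clamp (a, c) (b, d)) M := by
  obtain ⟨M, hM⟩ := h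
  refine ⟨M, fun p hp m => ?_⟩
  have hAB : ((a, c) : ℝ × ℝ) ≤ (b, d) := ⟨hab, hcd⟩
  set q : ℕ → ℝ × ℝ := fun i => clamp (a, c) (b, d) (p i) with hq
  have hqm : Monotone q := (clamp_monotone _ _).comp hp
  have hqmem : ∀ i, q i ∈ Icc ((a, c) : ℝ × ℝ) (b, d) := fun i => clamp_mem hAB _
  -- The chain is padded with the two corners, because Arzelà sums only allow chains from `(a, c)`
  -- to `(b, d)`; the two extra terms are nonnegative.
  set r : ℕ → ℝ × ℝ := fun k => if k = 0 then (a, c) else if k ≤ m + 1 then q (k - 1) else (b, d)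
    with hr
  have hr0 : r 0 = (a, c) := by simp [hr]
  have hrm : r (m + 2) = (b, d) := by simp [hr]
  have hrs : ∀ i ≤ m, r (i + 1) = q i := fun i hi => by simp [hr, hi]
  have hrmono : ∀ i < m + 2, r i ≤ r (i + 1) := by
    intro i hi
    rcases i with _ | i
    · rw [hr0, hrs 0 (Nat.zero_le _)]; exact (hqmem 0).1
    · rcases Nat.lt_or_ge i m with him | him
      · rw [hrs i him.le, hrs (i + 1) him]; exact hqm (Nat.le_succ i)
      · obtain rfl : i = m := by omega
        rw [hrs i le_rfl, hrm]; exact (hqmem i).2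
  have key := hM (m + 2) (fun i => (r i).1) (fun i => (r i).2) (by simp [hr0]) (by simp [hrm])
    (fun i hi => (hrmono i hi).1) (by simp [hr0]) (by simp [hrm]) (fun i hi => (hrmono i hi).2)
  rw [Finset.sum_range_succ, Finset.sum_range_succ'] at key
  have h1 : ∑ i ∈ Finset.range m, |f (q (i + 1)) - f (q i)| =
      ∑ i ∈ Finset.range m, |f ((r (i + 1 + 1)).1, (r (i + 1 + 1)).2) -
        f ((r (i + 1)).1, (r (i + 1)).2)| := by
    refine Finset.sum_congr rfl fun i hi => ?_
    have := Finset.mem_range.1 hi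
    rw [hrs i this.le, hrs (i + 1) this]
  change ∑ i ∈ Finset.range m, |f (q (i + 1)) - f (q i)| ≤ M
  rw [h1]
  refine le_trans ?_ key
  rw [add_assoc]
  exact le_add_of_nonneg_right (by positivity)

/-- Cutting off to an upper quadrant costs at most the supremum of the function. -/
theorem ChainVariationLE.indicator_Ici {g : ℝ × ℝ → ℝ} {M K : ℝ} (h : ChainVariationLE g M)
    (hK : ∀ p, |g p| ≤ K) (A : ℝ × ℝ) : ChainVariationLE ((Ici A).indicator g) (M + K) := by
  have hK0 : 0 ≤ K := (abs_nonneg _).trans (hK A)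
  have hM0 : 0 ≤ M := by simpa using h (fun _ => A) monotone_const 0
  have inside : ∀ p : ℕ → ℝ × ℝ, Monotone p → A ≤ p 0 → ∀ m,
      ∑ i ∈ Finset.range m, |(Ici A).indicator g (p (i + 1)) - (Ici A).indicator g (p i)| ≤ M := by
    intro p hp h0 m
    have hin : ∀ i, (Ici A).indicator g (p i) = g (p i) := fun i =>
      indicator_of_mem (s := Ici A) (h0.trans (hp (Nat.zero_le i))) g
    simpa only [hin] using h p hp m
  intro p hp m
  -- A nondecreasing sequence that enters the quadrant stays there, so it makes at most one jump
  -- from `0` to a value of `g`, which costs at most `K`.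
  induction m generalizing p with
  | zero => simpa using add_nonneg hM0 hK0
  | succ m ih =>
    by_cases h0 : A ≤ p 0
    · linarith [inside p hp h0 (m + 1)]
    have hp' : Monotone fun i => p (i + 1) := fun i j hij => hp (by omega)
    rw [Finset.sum_range_succ']
    have e0 : (Ici A).indicator g (p 0) = 0 := indicator_of_notMem (s := Ici A) h0 g
    by_cases h1 : A ≤ p 1
    · have := inside _ hp' h1 m
      have e1 : (Ici A).indicator g (p 1) = g (p 1) := indicator_of_mem (s := Ici A) h1 g
      simp only [zero_add, e0, e1, sub_zero]
      linarith [hK (p 1)]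
    · have e1 : (Ici A).indicator g (p 1) = 0 := indicator_of_notMem (s := Ici A) h1 g
      simpa [e0, e1] using ih _ hp'

/-- Convolution with an integrable kernel preserves bounded chain variation. -/
theorem ChainVariationLE.convolution {g k : ℝ × ℝ → ℝ} {M K : ℝ} (h : ChainVariationLE g M)
    (hg : Measurable g) (hK : ∀ p, |g p| ≤ K) (hk : Integrable k) :
    ChainVariationLE (fun p => ∫ z, k z * g (p - z)) ((∫ z, |k z|) * M) := by
  have hint : ∀ p, Integrable fun z => k z * g (p - z) := fun p =>
    hk.mul_bdd (hg.comp (measurable_const.sub measurable_id)).aestronglyMeasurable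
      (Eventually.of_forall fun z => hK (p - z))
  intro p hp m
  calc ∑ i ∈ Finset.range m, |(∫ z, k z * g (p (i + 1) - z)) - ∫ z, k z * g (p i - z)|
      ≤ ∑ i ∈ Finset.range m, ∫ z, |k z * g (p (i + 1) - z) - k z * g (p i - z)| := by
        refine Finset.sum_le_sum fun i _ => ?_
        rw [← integral_sub (hint _) (hint _)]
        exact abs_integral_le_integral_abs
    _ = ∫ z, ∑ i ∈ Finset.range m, |k z * g (p (i + 1) - z) - k z * g (p i - z)| :=
        (integral_finsetSum _ fun i _ => ((hint _).sub (hint _)).abs).symm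
    _ ≤ ∫ z, |k z| * M := by
        refine integral_mono (integrable_finsetSum _ fun i _ => ((hint _).sub (hint _)).abs)
          (hk.abs.mul_const M) fun z => ?_
        -- For each fixed `z` the translated chain is again a chain.
        have := h (fun i => p i - z) (fun i j hij => sub_le_sub_right (hp hij) z) m
        simp only [← mul_sub, abs_mul, ← Finset.mul_sum]
        exact mul_le_mul_of_nonneg_left this (abs_nonneg _)
    _ = (∫ z, |k z|) * M := integral_mul_const _ _

theorem ChainVariationLE.const_mul {g : ℝ × ℝ → ℝ} {M : ℝ} (h : ChainVariationLE g M) (C : ℝ) :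
    ChainVariationLE (fun p => C * g p) (|C| * M) := by
  intro p hp m
  simp only [← mul_sub, abs_mul, ← Finset.mul_sum]
  exact mul_le_mul_of_nonneg_left (h p hp m) (abs_nonneg _)

/-! ### The fractional integral as a convolution -/

/-- The power kernel `u ^ r` cut off to `(0, L]`. -/
noncomputable def powerKernel (L r : ℝ) : ℝ → ℝ := (Ioc 0 L).indicator fun u => u ^ r

theorem integrable_powerKernel {L r : ℝ} (hL : 0 ≤ L) (hr : -1 < r) :
    Integrable (powerKernel L r) := by
  have := intervalIntegral.intervalIntegrable_rpow' (a := 0) (b := L) hr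
  rw [intervalIntegrable_iff_integrableOn_Ioc_of_le hL] at this
  exact (integrable_indicator_iff measurableSet_Ioc).2 this

/-- Substitute `u = x - s`. The indicator enforces `u ≤ x - a`, so the kernel can be cut at `b - a`
and does not depend on `x`. -/
theorem intervalIntegral_eq_integral_powerKernel {a b x : ℝ} (hx : x ∈ Icc a b) (r : ℝ)
    (h : ℝ → ℝ) : ∫ s in a..x, (x - s) ^ r * h s =
      ∫ u, powerKernel (b - a) r u * (Ici a).indicator h (x - u) := by
  have h1 := intervalIntegral.integral_comp_sub_left (a := a) (b := x)
    (fun u => u ^ r * h (x - u)) x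
  simp only [sub_sub_cancel, sub_self] at h1
  rw [h1, intervalIntegral.integral_of_le (sub_nonneg.2 hx.1),
    ← integral_indicator measurableSet_Ioc]
  congr 1
  ext u
  by_cases hu : a ≤ x - u
  · have e : (Ici a).indicator h (x - u) = h (x - u) := indicator_of_mem hu h
    rw [e, powerKernel]
    by_cases h0 : 0 < u
    · rw [indicator_of_mem, indicator_of_mem] <;> constructor <;> linarith [hx.2]
    · rw [indicator_of_notMem (fun hh => h0 hh.1), indicator_of_notMem (fun hh => h0 hh.1),
        zero_mul]
  · have e : (Ici a).indicator h (x - u) = 0 := indicator_of_notMem hu h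
    rw [e, mul_zero, indicator_of_notMem]
    exact fun hh => hu (by linarith [hh.2])

/-- Fubini and the one-variable substitution in each coordinate. The kernel lives on positive `z`,
so `p - z ≤ (b, d)`; where the indicator is also nonzero, `p - z` lies in the rectangle and the
clamp is the identity. -/
theorem fractionalIntegral_eq_convolution {a b c d α β K : ℝ} (hab : a ≤ b) (hcd : c ≤ d)
    (hα : 0 < α) (hβ : 0 < β) {f : ℝ × ℝ → ℝ}
    (hm : Measurable ((Ici ((a, c) : ℝ × ℝ)).indicator (f ∘ clamp (a, c) (b, d))))
    (hK : ∀ p, |(Ici ((a, c) : ℝ × ℝ)).indicator (f ∘ clamp (a, c) (b, d)) p| ≤ K)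
    {p : ℝ × ℝ} (hp : p ∈ Icc ((a, c) : ℝ × ℝ) (b, d)) :
    fractionalIntegral a c α β f p = 1 / (Real.Gamma α * Real.Gamma β) *
      ∫ z : ℝ × ℝ, (powerKernel (b - a) (α - 1) z.1 * powerKernel (d - c) (β - 1) z.2) *
        (Ici ((a, c) : ℝ × ℝ)).indicator (f ∘ clamp (a, c) (b, d)) (p - z) := by
  obtain ⟨x, y⟩ := p
  have hx : x ∈ Icc a b := ⟨hp.1.1, hp.2.1⟩
  have hy : y ∈ Icc c d := ⟨hp.1.2, hp.2.2⟩
  have hk : Integrable fun z : ℝ × ℝ =>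
      powerKernel (b - a) (α - 1) z.1 * powerKernel (d - c) (β - 1) z.2 :=
    (integrable_powerKernel (sub_nonneg.2 hab) (by linarith)).mul_prod
      (integrable_powerKernel (sub_nonneg.2 hcd) (by linarith))
  have hint : Integrable fun z : ℝ × ℝ =>
      (powerKernel (b - a) (α - 1) z.1 * powerKernel (d - c) (β - 1) z.2) *
        (Ici ((a, c) : ℝ × ℝ)).indicator (f ∘ clamp (a, c) (b, d)) ((x, y) - z) :=
    hk.mul_bdd (hm.comp (measurable_const.sub measurable_id)).aestronglyMeasurable
      (Eventually.of_forall fun z => hK _)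
  rw [fractionalIntegral, Measure.volume_eq_prod, integral_prod _ hint]
  congr 1
  simp only [mul_assoc, intervalIntegral.integral_const_mul]
  simp only [intervalIntegral_eq_integral_powerKernel hy,
    intervalIntegral_eq_integral_powerKernel hx, integral_const_mul]
  congr 1
  ext u
  by_cases hu : u ∈ Ioc 0 (b - a)
  swap
  · simp [powerKernel, hu]
  congr 1
  by_cases hxu : a ≤ x - u
  · have e : ∀ h : ℝ → ℝ, (Ici a).indicator h (x - u) = h (x - u) :=
      fun h => indicator_of_mem hxu h
    rw [e]
    congr 1
    ext v
    by_cases hv : v ∈ Ioc 0 (d - c)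
    swap
    · simp [powerKernel, hv]
    congr 1
    by_cases hyv : c ≤ y - v
    · have h2 : ((x, y) - (u, v) : ℝ × ℝ) ∈ Ici ((a, c) : ℝ × ℝ) := ⟨hxu, hyv⟩
      have h1 : ((x, y) - (u, v) : ℝ × ℝ) ∈ Icc ((a, c) : ℝ × ℝ) (b, d) :=
        ⟨h2, ⟨by simpa using by linarith [hx.2, hu.1], by simpa using by linarith [hy.2, hv.1]⟩⟩
      rw [indicator_of_mem (show y - v ∈ Ici c from hyv), indicator_of_mem h2,
        Function.comp_apply, clamp_of_mem h1]
      rfl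
    · rw [indicator_of_notMem (show y - v ∉ Ici c from hyv), indicator_of_notMem]
      exact fun hh => hyv hh.2
  · have e : (Ici a).indicator (fun s => ∫ v, powerKernel (d - c) (β - 1) v *
        (Ici c).indicator (fun t => f (s, t)) (y - v)) (x - u) = 0 := indicator_of_notMem hxu _
    rw [e]
    symm
    refine integral_eq_zero_of_ae (Eventually.of_forall fun v => ?_)
    have e2 : (Ici ((a, c) : ℝ × ℝ)).indicator (f ∘ clamp (a, c) (b, d)) ((x, y) - (u, v)) = 0 :=
      indicator_of_notMem (fun hh => hxu hh.1) _
    simp only [e2, mul_zero, Pi.zero_apply]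

/-- The fractional integral coincides on the rectangle with a function of bounded chain
variation. -/
theorem exists_chainVariationLE_eqOn_fractionalIntegral {a b c d α β : ℝ} (hab : a ≤ b)
    (hcd : c ≤ d) (hα : 0 < α) (hβ : 0 < β) {f : ℝ × ℝ → ℝ}
    (hcont : ContinuousOn f (Icc a b ×ˢ Icc c d)) (hbv : ArzelaBV a b c d f) :
    ∃ (F : ℝ × ℝ → ℝ) (M : ℝ), ChainVariationLE F M ∧
      EqOn (fractionalIntegral a c α β f) F (Icc a b ×ˢ Icc c d) := by
  have hR : Icc a b ×ˢ Icc c d = Icc ((a, c) : ℝ × ℝ) (b, d) := (Icc_prod_eq (a, c) (b, d)).symm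
  have hAB : ((a, c) : ℝ × ℝ) ≤ (b, d) := ⟨hab, hcd⟩
  rw [hR] at hcont ⊢
  obtain ⟨M, hM⟩ := hbv.chainVariationLE hab hcd
  obtain ⟨K, hK⟩ := isCompact_Icc.exists_bound_of_continuousOn hcont
  have hK0 : 0 ≤ K := (norm_nonneg _).trans (hK _ (left_mem_Icc.2 hAB))
  have hK' : ∀ p, |(f ∘ clamp (a, c) (b, d)) p| ≤ K := fun p => hK _ (clamp_mem hAB p)
  have hg : Measurable ((Ici ((a, c) : ℝ × ℝ)).indicator (f ∘ clamp (a, c) (b, d))) :=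
    (hcont.comp_continuous (continuous_clamp _ _) (clamp_mem hAB)).measurable.indicator
      measurableSet_Ici
  have hgK : ∀ p, |(Ici ((a, c) : ℝ × ℝ)).indicator (f ∘ clamp (a, c) (b, d)) p| ≤ K := by
    intro p
    by_cases hp : p ∈ Ici ((a, c) : ℝ × ℝ)
    · rw [indicator_of_mem hp]; exact hK' p
    · rw [indicator_of_notMem hp]; simpa using hK0
  have hk : Integrable fun z : ℝ × ℝ =>
      powerKernel (b - a) (α - 1) z.1 * powerKernel (d - c) (β - 1) z.2 :=
    (integrable_powerKernel (sub_nonneg.2 hab) (by linarith)).mul_prod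
      (integrable_powerKernel (sub_nonneg.2 hcd) (by linarith))
  exact ⟨_, _, (((hM.indicator_Ici hK' _).convolution hg hgK hk).const_mul
    (1 / (Real.Gamma α * Real.Gamma β))), fun p hp =>
    fractionalIntegral_eq_convolution hab hcd hα hβ hg hgK hp⟩

/-! ### Oscillation over grid cells -/

theorem ChainVariationLE.abs_sub_le {F : ℝ × ℝ → ℝ} {M : ℝ} (h : ChainVariationLE F M)
    {x y : ℝ × ℝ} (hxy : x ≤ y) : |F y - F x| ≤ M := by
  have := h (fun k => if k = 0 then x else y) (monotone_nat_of_le_succ fun k => by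
    rcases k with _ | k <;> simp [hxy]) 1
  simpa using this

/-- A cell contains a point at which half of the oscillation from its lower corner is attained. -/
theorem ChainVariationLE.exists_half_oscillation {F : ℝ × ℝ → ℝ} {M : ℝ}
    (h : ChainVariationLE F M) {A B : ℝ × ℝ} (hAB : A ≤ B) :
    ∃ p ∈ Icc A B, ∀ q ∈ Icc A B, |F q - F A| ≤ 2 * |F p - F A| := by
  set S := (fun q => |F q - F A|) '' Icc A B with hS
  have hbdd : BddAbove S := ⟨M, by rintro _ ⟨q, hq, rfl⟩; exact h.abs_sub_le hq.1⟩
  have hne : S.Nonempty := ⟨_, A, left_mem_Icc.2 hAB, rfl⟩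
  have hle : ∀ q ∈ Icc A B, |F q - F A| ≤ sSup S := fun q hq => le_csSup hbdd ⟨q, hq, rfl⟩
  -- The supremum need not be attained, but if positive it is exceeded by twice some value.
  rcases le_or_gt (sSup S) 0 with h0 | h0
  · exact ⟨A, left_mem_Icc.2 hAB, fun q hq => by simpa using (hle q hq).trans h0⟩
  · obtain ⟨_, ⟨p, hp, rfl⟩, hlt⟩ := exists_lt_of_lt_csSup hne (half_lt_self h0)
    exact ⟨p, hp, fun q hq => by linarith [hle q hq]⟩

theorem sum_even_le_sum_range {t : ℕ → ℝ} (ht : ∀ i, 0 ≤ t i) (n : ℕ) :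
    ∑ i ∈ Finset.range n, t (2 * i) ≤ ∑ k ∈ Finset.range (2 * n), t k := by
  induction n with
  | zero => simp
  | succ n ih =>
    rw [show 2 * (n + 1) = 2 * n + 1 + 1 by ring, Finset.sum_range_succ, Finset.sum_range_succ,
      Finset.sum_range_succ]
    linarith [ht (2 * n + 1)]

/-- Put `j = i + (e - n)`: the entries of row `i` correspond to `n - i ≤ e < 2 * n - i`, inside the
range of `e`. The diagonals leave the square, hence integer indices; the surplus terms are
nonnegative. -/
theorem sum_square_le_sum_diagonals {g : ℤ → ℤ → ℝ} (hg : ∀ i j, 0 ≤ g i j) (n : ℕ) :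
    ∑ i ∈ Finset.range n, ∑ j ∈ Finset.range n, g i j ≤
      ∑ e ∈ Finset.range (2 * n), ∑ i ∈ Finset.range n, g i (i + (e - n)) := by
  rw [Finset.sum_comm (s := Finset.range (2 * n))]
  refine Finset.sum_le_sum fun i hi => ?_
  have hi := Finset.mem_range.1 hi
  calc ∑ j ∈ Finset.range n, g i j
      = ∑ e ∈ Finset.Ico (n - i) (2 * n - i), g i (i + ((e : ℤ) - n)) := by
        rw [Finset.sum_Ico_eq_sum_range, show 2 * n - i - (n - i) = n by omega]
        refine Finset.sum_congr rfl fun j _ => ?_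
        congr 1
        omega
    _ ≤ _ := Finset.sum_le_sum_of_subset_of_nonneg
        (fun e he => by rw [Finset.mem_Ico] at he; rw [Finset.mem_range]; omega)
        fun _ _ _ => hg _ _

/-- On an `n × n` grid the deviations from the lower corners of the cells sum to `O(n)`: the cells
of each diagonal form a chain. -/
theorem ChainVariationLE.sum_grid_le {F : ℝ × ℝ → ℝ} {M : ℝ} (h : ChainVariationLE F M)
    {c P : ℤ → ℤ → ℝ × ℝ} (hP : ∀ i j, P i j ∈ Icc (c i j) (c (i + 1) (j + 1))) (n : ℕ) :
    ∑ i ∈ Finset.range n, ∑ j ∈ Finset.range n, |F (P i j) - F (c i j)| ≤ 2 * n * M := by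
  refine (sum_square_le_sum_diagonals (g := fun i j => |F (P i j) - F (c i j)|)
    (fun _ _ => abs_nonneg _) n).trans ?_
  have diag : ∀ e : ℤ,
      ∑ i ∈ Finset.range n, |F (P i (i + e)) - F (c i (i + e))| ≤ M := by
    intro e
    -- Interleave the lower corners along the diagonal with the chosen points; the even-indexed
    -- increments are the deviations to be summed.
    set q : ℕ → ℝ × ℝ := fun k =>
      if k % 2 = 0 then c (k / 2 : ℕ) ((k / 2 : ℕ) + e) else P (k / 2 : ℕ) ((k / 2 : ℕ) + e)
      with hq
    have he : ∀ i : ℕ, q (2 * i) = c i (i + e) := fun i => by simp [hq]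
    have ho : ∀ i : ℕ, q (2 * i + 1) = P i (i + e) := fun i => by
      have h1 : (2 * i + 1) % 2 = 1 := by omega
      have h2 : (2 * i + 1) / 2 = i := by omega
      simp only [hq, h1, h2, one_ne_zero, if_false]
    have hmono : Monotone q := by
      refine monotone_nat_of_le_succ fun k => ?_
      obtain ⟨i, rfl | rfl⟩ := k.even_or_odd'
      · rw [he, ho]; exact (hP _ _).1
      · rw [ho, show 2 * i + 1 + 1 = 2 * (i + 1) by ring, he]
        have := (hP i (i + e)).2
        rwa [show (i : ℤ) + e + 1 = ((i + 1 : ℕ) : ℤ) + e by push_cast; ring,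
          show (i : ℤ) + 1 = ((i + 1 : ℕ) : ℤ) by push_cast; ring] at this
    have := (sum_even_le_sum_range (t := fun k => |F (q (k + 1)) - F (q k)|)
      (fun _ => abs_nonneg _) n).trans (h q hmono (2 * n))
    simpa only [he, ho] using this
  calc ∑ e ∈ Finset.range (2 * n), ∑ i ∈ Finset.range n,
        |F (P i (i + ((e : ℤ) - n))) - F (c i (i + ((e : ℤ) - n)))|
      ≤ ∑ _e ∈ Finset.range (2 * n), M := Finset.sum_le_sum fun e _ => diag _
    _ = 2 * n * M := by simp

theorem exists_grid_index {a b x : ℝ} (hab : a < b) (hx : x ∈ Icc a b) {n : ℕ} (hn : 0 < n) :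
    ∃ i < n, a + i * ((b - a) / n) ≤ x ∧ x ≤ a + (i + 1) * ((b - a) / n) := by
  have hn' : (0 : ℝ) < n := Nat.cast_pos.2 hn
  have hh : 0 < (b - a) / n := div_pos (sub_pos.2 hab) hn'
  -- At the right endpoint the floor would give the index `n`, so the last cell is used.
  rcases hx.2.eq_or_lt with rfl | hlt
  · refine ⟨n - 1, by omega, ?_, ?_⟩ <;> rw [Nat.cast_pred hn]
    · have : ((n : ℝ) - 1) * ((x - a) / n) = x - a - (x - a) / n := by field_simp
      linarith
    · have : ((n : ℝ) - 1 + 1) * ((x - a) / n) = x - a := by field_simp; ring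
      linarith
  · refine ⟨⌊(x - a) / ((b - a) / n)⌋₊, ?_, ?_, ?_⟩
    · rw [Nat.floor_lt (div_nonneg (sub_nonneg.2 hx.1) hh.le), div_lt_iff₀ hh]
      have : (n : ℝ) * ((b - a) / n) = b - a := by field_simp
      linarith
    · have := Nat.floor_le (div_nonneg (sub_nonneg.2 hx.1) hh.le)
      rw [le_div_iff₀ hh] at this
      linarith
    · have := (Nat.lt_floor_add_one ((x - a) / ((b - a) / n))).le
      rw [div_le_iff₀ hh] at this
      linarith

/-! ### Covering the graph by boxes -/

/-- An axis-parallel box with lower vertex `v` and side lengths `l`. -/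
def box (v l : Fin 3 → ℝ) : Set (EuclideanSpace ℝ (Fin 3)) :=
  {w | ∀ i, w i ∈ Icc (v i) (v i + l i)}

theorem ediam_box_le (v : Fin 3 → ℝ) {l : Fin 3 → ℝ} (hl : ∀ i, 0 ≤ l i) :
    Metric.ediam (box v l) ≤ ENNReal.ofReal (l 0 + l 1 + l 2) := by
  refine Metric.ediam_le fun x hx y hy => ?_
  rw [edist_dist]
  refine ENNReal.ofReal_le_ofReal ?_
  have hd : ∀ i, dist (x i) (y i) ≤ l i := fun i => by
    rw [Real.dist_eq, abs_le]
    have h1 := hx i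
    have h2 := hy i
    constructor <;> linarith [h1.1, h1.2, h2.1, h2.2]
  have hs : ∀ i, dist (x i) (y i) ^ 2 ≤ l i ^ 2 := fun i =>
    pow_le_pow_left₀ dist_nonneg (hd i) 2
  rw [EuclideanSpace.dist_eq, Fin.sum_univ_three]
  refine Real.sqrt_le_iff.2 ⟨by linarith [hl 0, hl 1, hl 2], ?_⟩
  nlinarith [hs 0, hs 1, hs 2, mul_nonneg (hl 0) (hl 1), mul_nonneg (hl 0) (hl 2),
    mul_nonneg (hl 1) (hl 2)]

/-- `G` is covered by `C n²` sets of diameter at most `L / n`, for every `n ≥ 1`. -/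
def QuadraticCover {m : ℕ} (G : Set (EuclideanSpace ℝ (Fin m))) (C L : ℝ) : Prop :=
  ∀ n : ℕ, 0 < n → ∃ k : ℕ, (k : ℝ) ≤ C * n ^ 2 ∧
    ∃ U : Fin k → Set (EuclideanSpace ℝ (Fin m)),
      (∀ i, Metric.ediam (U i) ≤ ENNReal.ofReal (L / n)) ∧ G ⊆ ⋃ i, U i

/-- The graph of a function of bounded chain variation is covered by `O(n²)` sets of diameter
`O(1/n)`. -/
theorem ChainVariationLE.exists_quadraticCover_graphOver {F : ℝ × ℝ → ℝ} {M : ℝ}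
    (h : ChainVariationLE F M) {a b c d : ℝ} (hab : a < b) (hcd : c < d) :
    ∃ C L : ℝ, 0 < C ∧ 0 < L ∧ QuadraticCover (graphOver (Icc a b ×ˢ Icc c d) F) C L := by
  have hM : 0 ≤ M := by simpa using h (fun _ => 0) monotone_const 0
  refine ⟨8 * M + 1, (b - a) + (d - c) + 1, by positivity, by linarith, fun n hn => ?_⟩
  have hn' : (0 : ℝ) < n := Nat.cast_pos.2 hn
  set h₁ := (b - a) / n with hh₁
  set h₂ := (d - c) / n with hh₂
  have h₁0 : 0 ≤ h₁ := div_nonneg (by linarith) hn'.le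
  have h₂0 : 0 ≤ h₂ := div_nonneg (by linarith) hn'.le
  let V : ℤ → ℤ → ℝ × ℝ := fun i j => (a + i * h₁, c + j * h₂)
  have hV : ∀ i j, V i j ≤ V (i + 1) (j + 1) := fun i j => by
    constructor <;> simp only [V] <;> push_cast <;> linarith
  choose P hP hPV using fun i j => h.exists_half_oscillation (hV i j)
  let g : ℤ → ℤ → ℝ := fun i j => |F (P i j) - F (V i j)|
  have hg : ∀ i j, 0 ≤ g i j := fun i j => abs_nonneg _
  -- Over a cell the values lie within `2 * g` of the corner value, a range of length `4 * g`, cut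
  -- into slices of height `1 / n`. With `∑ g ≤ 2 * n * M` this gives the constant `8 * M + 1`.
  let ι := Σ ij : Fin n × Fin n, Fin (⌊4 * g ij.1 ij.2 * n⌋₊ + 1)
  let U : ι → Set (EuclideanSpace ℝ (Fin 3)) := fun x =>
    box ![(V x.1.1 x.1.2).1, (V x.1.1 x.1.2).2,
      F (V x.1.1 x.1.2) - 2 * g x.1.1 x.1.2 + (x.2 : ℕ) / n] ![h₁, h₂, 1 / n]
  have hcard : (Fintype.card ι : ℝ) ≤ (8 * M + 1) * n ^ 2 := by
    have hs := h.sum_grid_le hP n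
    simp only [ι, Fintype.card_sigma, Fintype.card_fin, Fintype.sum_prod_type]
    push_cast
    calc ∑ i : Fin n, ∑ j : Fin n, ((⌊4 * g i j * n⌋₊ : ℝ) + 1)
        ≤ ∑ i : Fin n, ∑ j : Fin n, (4 * n * g i j + 1) := by
          refine Finset.sum_le_sum fun i _ => Finset.sum_le_sum fun j _ => ?_
          have := Nat.floor_le (a := 4 * g i j * n) (by have := hg i j; positivity)
          linarith
      _ = 4 * n * ∑ i ∈ Finset.range n, ∑ j ∈ Finset.range n, g i j + n ^ 2 := by
          simp only [Finset.sum_add_distrib, ← Finset.mul_sum, Finset.sum_range]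
          simp
          ring
      _ ≤ 4 * n * (2 * n * M) + n ^ 2 := by gcongr
      _ = (8 * M + 1) * n ^ 2 := by ring
  refine ⟨Fintype.card ι, hcard, fun k => U ((Fintype.equivFin ι).symm k), fun k => ?_, ?_⟩
  · refine (ediam_box_le _ ?_).trans_eq ?_
    · intro i
      fin_cases i <;> simp [h₁0, h₂0]
    · congr 1
      simp [hh₁, hh₂]
      ring
  · rintro _ ⟨⟨x, y⟩, ⟨hx, hy⟩, rfl⟩
    obtain ⟨i, hi, hxi, hxi'⟩ := exists_grid_index hab hx hn
    obtain ⟨j, hj, hyj, hyj'⟩ := exists_grid_index hcd hy hn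
    have hcell : (x, y) ∈ Icc (V i j) (V (i + 1) (j + 1)) := by
      refine ⟨⟨?_, ?_⟩, ⟨?_, ?_⟩⟩ <;> simp only [V] <;> push_cast <;> assumption
    have hosc := abs_le.1 (hPV i j _ hcell)
    change -(2 * g i j) ≤ _ ∧ _ ≤ 2 * g i j at hosc
    set t := (F (x, y) - F (V i j) + 2 * g i j) * n with ht
    have ht0 : 0 ≤ t := mul_nonneg (by linarith) hn'.le
    have htF : F (x, y) = F (V i j) - 2 * g i j + t / n := by
      rw [ht]; field_simp; ring
    have hlt : ⌊t⌋₊ < ⌊4 * g i j * n⌋₊ + 1 :=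
      Nat.lt_succ_of_le (Nat.floor_le_floor (mul_le_mul_of_nonneg_right (by linarith) hn'.le))
    refine mem_iUnion.2 ⟨Fintype.equivFin ι ⟨(⟨i, hi⟩, ⟨j, hj⟩), ⟨⌊t⌋₊, hlt⟩⟩, ?_⟩
    rw [Equiv.symm_apply_apply]
    intro m
    have hf1 : (⌊t⌋₊ : ℝ) / n ≤ t / n := by gcongr; exact Nat.floor_le ht0
    have hf2 : t / n ≤ (⌊t⌋₊ : ℝ) / n + 1 / n := by
      rw [← add_div]; gcongr; exact (Nat.lt_floor_add_one t).le
    fin_cases m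
    · simp only [V]
      constructor <;> simp <;> linarith
    · simp only [V]
      constructor <;> simp <;> linarith
    · refine ⟨?_, ?_⟩
      · simp [htF, hf1]
      · simpa [htF, add_assoc] using hf2

/-! ### Upper bounds from quadratic covers -/

variable {m : ℕ} {G : Set (EuclideanSpace ℝ (Fin m))} {C L : ℝ}

theorem QuadraticCover.isBounded (h : QuadraticCover G C L) : Bornology.IsBounded G := by
  obtain ⟨k, -, U, hU, hG⟩ := h 1 one_pos
  refine (Bornology.isBounded_iUnion.2 fun i => ?_).subset hG
  exact Metric.isBounded_iff_ediam_ne_top.2 ((hU i).trans_lt ENNReal.ofReal_lt_top).ne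

/-- The squared diameters sum to at most `C * n ^ 2 * (L / n) ^ 2 = C * L ^ 2` at every scale, so
the 2-dimensional Hausdorff measure is finite. -/
theorem QuadraticCover.dimH_le (h : QuadraticCover G C L) (hL : 0 ≤ L) : dimH G ≤ 2 := by
  choose k hk U hU hG using fun n : ℕ => h (n + 1) n.succ_pos
  have hlim : Tendsto (fun n : ℕ => ENNReal.ofReal (L / (n + 1 : ℕ))) atTop (𝓝 0) := by
    rw [← ENNReal.ofReal_zero]
    exact ENNReal.tendsto_ofReal
      ((tendsto_const_div_atTop_nhds_zero_nat L).comp (tendsto_add_atTop_nat 1))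
  have hH := Measure.hausdorffMeasure_le_liminf_sum (2 : ℝ) G _ hlim U
    (Eventually.of_forall hU) (Eventually.of_forall hG)
  have hsum : ∀ n, ∑ i, Metric.ediam (U n i) ^ (2 : ℝ) ≤ ENNReal.ofReal (C * L ^ 2) := by
    intro n
    have hn : (0 : ℝ) < (n + 1 : ℕ) := Nat.cast_pos.2 n.succ_pos
    calc ∑ i, Metric.ediam (U n i) ^ (2 : ℝ)
        ≤ ∑ _i : Fin (k n), ENNReal.ofReal ((L / (n + 1 : ℕ)) ^ 2) := by
          refine Finset.sum_le_sum fun i _ => ?_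
          rw [ENNReal.ofReal_pow (by positivity), ENNReal.rpow_two]
          exact pow_le_pow_left' (hU n i) 2
      _ = ENNReal.ofReal (k n * (L / (n + 1 : ℕ)) ^ 2) := by
          rw [ENNReal.ofReal_mul (Nat.cast_nonneg _), ENNReal.ofReal_natCast]
          simp
      _ ≤ ENNReal.ofReal (C * L ^ 2) := by
          refine ENNReal.ofReal_le_ofReal ?_
          calc (k n : ℝ) * (L / (n + 1 : ℕ)) ^ 2
              ≤ C * (n + 1 : ℕ) ^ 2 * (L / (n + 1 : ℕ)) ^ 2 :=
                mul_le_mul_of_nonneg_right (hk n) (by positivity)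
            _ = C * L ^ 2 := by field_simp
  have hfin : μH[((2 : NNReal) : ℝ)] G ≠ ⊤ := by
    refine ne_top_of_le_ne_top (ENNReal.ofReal_ne_top (r := C * L ^ 2)) ?_
    refine hH.trans ((liminf_le_liminf (Eventually.of_forall hsum)).trans ?_)
    simp
  simpa using dimH_le_of_hausdorffMeasure_ne_top hfin

/-- Take `n = ⌈L / δ⌉₊`; since `δ ≤ L`, rounding up at most doubles `L / δ`, whence the factor 4. -/
theorem QuadraticCover.exists_cover (h : QuadraticCover G C L) (hC : 0 ≤ C) (hL : 0 < L) {δ : ℝ}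
    (hδ : 0 < δ) (hδL : δ ≤ L) : ∃ k : ℕ, (k : ℝ) ≤ 4 * C * L ^ 2 / δ ^ 2 ∧
      ∃ U : Fin k → Set (EuclideanSpace ℝ (Fin m)),
        (∀ i, Metric.ediam (U i) ≤ ENNReal.ofReal δ) ∧ G ⊆ ⋃ i, U i := by
  have hn : 0 < ⌈L / δ⌉₊ := Nat.ceil_pos.2 (div_pos hL hδ)
  obtain ⟨k, hk, U, hU, hG⟩ := h _ hn
  refine ⟨k, hk.trans ?_, U, fun i => (hU i).trans (ENNReal.ofReal_le_ofReal ?_), hG⟩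
  · have h1 : (⌈L / δ⌉₊ : ℝ) ≤ 2 * (L / δ) := by
      have := (Nat.ceil_lt_add_one (div_pos hL hδ).le).le
      have h2 : 1 ≤ L / δ := (one_le_div hδ).2 hδL
      linarith
    calc C * (⌈L / δ⌉₊ : ℝ) ^ 2 ≤ C * (2 * (L / δ)) ^ 2 := by gcongr
      _ = 4 * C * L ^ 2 / δ ^ 2 := by rw [mul_pow, div_pow]; ring
  · rw [div_le_iff₀ (Nat.cast_pos.2 hn)]
    have := Nat.le_ceil (L / δ)
    rw [div_le_iff₀ hδ] at this
    linarith

theorem QuadraticCover.coverNumber_le (h : QuadraticCover G C L) (hC : 0 ≤ C) (hL : 0 < L) {δ : ℝ}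
    (hδ : 0 < δ) (hδL : δ ≤ L) : (coverNumber G δ : ℝ) ≤ 4 * C * L ^ 2 / δ ^ 2 := by
  obtain ⟨k, hk, hU⟩ := h.exists_cover hC hL hδ hδL
  exact (Nat.cast_le.2 (Nat.sInf_le hU)).trans hk

/-! ### Lower bounds by projection -/

/-- The projection of `ℝ³` to the plane of the first two coordinates. -/
def planeProj (v : EuclideanSpace ℝ (Fin 3)) : ℝ × ℝ := (v 0, v 1)

theorem lipschitzWith_planeProj : LipschitzWith 1 planeProj := by
  refine LipschitzWith.of_dist_le_mul fun x y => ?_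
  rw [NNReal.coe_one, one_mul, Prod.dist_eq]
  have h : ∀ i, dist (x i) (y i) ≤ dist x y := fun i => by
    rw [EuclideanSpace.dist_eq]
    exact Real.le_sqrt_of_sq_le
      (Finset.single_le_sum (f := fun i => dist (x i) (y i) ^ 2) (fun _ _ => sq_nonneg _)
        (Finset.mem_univ i))
  exact max_le (h 0) (h 1)

theorem planeProj_image_graphOver (A : Set (ℝ × ℝ)) (F : ℝ × ℝ → ℝ) :
    planeProj '' graphOver A F = A := by
  rw [graphOver, image_image]
  simp [planeProj]

theorem two_le_dimH_graphOver {A : Set (ℝ × ℝ)} (hA : (interior A).Nonempty) (F : ℝ × ℝ → ℝ) :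
    2 ≤ dimH (graphOver A F) := by
  have h := lipschitzWith_planeProj.dimH_image_le (graphOver A F)
  rw [planeProj_image_graphOver, Real.dimH_of_nonempty_interior hA] at h
  simpa using h

theorem volume_le_of_ediam_le {S : Set (ℝ × ℝ)} {δ : ℝ} (hδ : 0 ≤ δ)
    (hS : Metric.ediam S ≤ ENNReal.ofReal δ) : volume S ≤ ENNReal.ofReal (4 * δ ^ 2) := by
  rcases S.eq_empty_or_nonempty with rfl | ⟨p, hp⟩
  · simp
  have hsub : S ⊆ Metric.closedBall p.1 δ ×ˢ Metric.closedBall p.2 δ := by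
    rw [closedBall_prod_same]
    intro q hq
    have := (Metric.edist_le_ediam_of_mem hq hp).trans hS
    rwa [edist_dist, ENNReal.ofReal_le_ofReal_iff hδ] at this
  refine (measure_mono hsub).trans_eq ?_
  rw [Measure.volume_eq_prod, Measure.prod_prod, Real.volume_closedBall, Real.volume_closedBall,
    ← ENNReal.ofReal_mul (by positivity)]
  congr 1
  ring

/-- The projected pieces cover `A`, and each lies in a square of side `2 * δ`. A finite cover must
be assumed because `sInf ∅ = 0` in `ℕ`. -/
theorem le_coverNumber_graphOver {A : Set (ℝ × ℝ)} {F : ℝ × ℝ → ℝ} {δ : ℝ} (hδ : 0 < δ)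
    (hne : ∃ k : ℕ, ∃ U : Fin k → Set (EuclideanSpace ℝ (Fin 3)),
      (∀ i, Metric.ediam (U i) ≤ ENNReal.ofReal δ) ∧ graphOver A F ⊆ ⋃ i, U i) :
    (volume A).toReal / (4 * δ ^ 2) ≤ coverNumber (graphOver A F) δ := by
  obtain ⟨U, hU, hG⟩ := Nat.sInf_mem hne
  change Fin (coverNumber (graphOver A F) δ) → _ at U
  rw [div_le_iff₀ (by positivity)]
  refine ENNReal.toReal_le_of_le_ofReal (by positivity) ?_
  calc volume A ≤ volume (⋃ i, planeProj '' U i) := by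
        refine measure_mono ?_
        rw [← image_iUnion]
        exact (planeProj_image_graphOver A F).symm.subset.trans (image_mono hG)
    _ ≤ ∑ i, volume (planeProj '' U i) := measure_iUnion_fintype_le _ _
    _ ≤ ∑ _i : Fin (coverNumber (graphOver A F) δ), ENNReal.ofReal (4 * δ ^ 2) := by
        refine Finset.sum_le_sum fun i _ => volume_le_of_ediam_le hδ.le ?_
        have := lipschitzWith_planeProj.ediam_image_le (U i)
        rw [ENNReal.coe_one, one_mul] at this
        exact this.trans (hU i)
    _ = ENNReal.ofReal (coverNumber (graphOver A F) δ * (4 * δ ^ 2)) := by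
        rw [ENNReal.ofReal_mul (Nat.cast_nonneg _), ENNReal.ofReal_natCast]
        simp

/-! ### Logarithmic limits and conclusion -/

theorem tendsto_log_const_div_sq {K : ℝ} (hK : 0 < K) :
    Tendsto (fun δ : ℝ => Real.log (K / δ ^ 2) / (-Real.log δ)) (𝓝[>] 0) (𝓝 2) := by
  have hlog : Tendsto (fun δ : ℝ => -Real.log δ) (𝓝[>] 0) atTop :=
    tendsto_neg_atBot_atTop.comp Real.tendsto_log_nhdsGT_zero
  have h1 : Tendsto (fun δ : ℝ => Real.log K / (-Real.log δ) + 2) (𝓝[>] 0) (𝓝 2) := by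
    simpa using (hlog.const_div_atTop (Real.log K)).add_const 2
  refine h1.congr' ?_
  filter_upwards [self_mem_nhdsWithin, hlog.eventually_gt_atTop 0] with δ hδ hl
  have hδ : 0 < δ := hδ
  rw [Real.log_div hK.ne' (by positivity), Real.log_pow, sub_eq_add_neg, add_div]
  congr 1
  rw [Nat.cast_ofNat, ← mul_neg, mul_div_assoc, div_self hl.ne', mul_one]

theorem tendsto_log_div_of_le_of_le {N : ℝ → ℝ} {K₁ K₂ : ℝ} (h₁ : 0 < K₁) (h₂ : 0 < K₂)
    (hlow : ∀ᶠ δ in 𝓝[>] 0, K₁ / δ ^ 2 ≤ N δ) (hup : ∀ᶠ δ in 𝓝[>] 0, N δ ≤ K₂ / δ ^ 2) :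
    Tendsto (fun δ : ℝ => Real.log (N δ) / (-Real.log δ)) (𝓝[>] 0) (𝓝 2) := by
  have hlog : ∀ᶠ δ : ℝ in 𝓝[>] 0, 0 < -Real.log δ :=
    (tendsto_neg_atBot_atTop.comp Real.tendsto_log_nhdsGT_zero).eventually_gt_atTop 0
  refine tendsto_of_tendsto_of_tendsto_of_le_of_le' (tendsto_log_const_div_sq h₁)
    (tendsto_log_const_div_sq h₂) ?_ ?_
  · filter_upwards [self_mem_nhdsWithin, hlog, hlow] with δ hδ hl h
    have hδ : 0 < δ := hδ
    exact div_le_div_of_nonneg_right (Real.log_le_log (by positivity) h) hl.le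
  · filter_upwards [self_mem_nhdsWithin, hlog, hlow, hup] with δ hδ hl h h'
    have hδ : 0 < δ := hδ
    exact div_le_div_of_nonneg_right
      (Real.log_le_log ((by positivity : 0 < K₁ / δ ^ 2).trans_le h) h') hl.le

/-- The graph over a nondegenerate rectangle of a function of bounded chain variation has box and
Hausdorff dimension two. -/
theorem ChainVariationLE.hasBoxDim_graphOver_and_dimH {F : ℝ × ℝ → ℝ} {M : ℝ}
    (h : ChainVariationLE F M) {a b c d : ℝ} (hab : a < b) (hcd : c < d) :
    HasBoxDim (graphOver (Icc a b ×ˢ Icc c d) F) 2 ∧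
      dimH (graphOver (Icc a b ×ˢ Icc c d) F) = 2 := by
  obtain ⟨C, L, hC, hL, hcov⟩ := h.exists_quadraticCover_graphOver hab hcd
  have hint : (interior (Icc a b ×ˢ Icc c d)).Nonempty := by
    rw [interior_prod_eq, interior_Icc, interior_Icc]
    exact (nonempty_Ioo.2 hab).prod (nonempty_Ioo.2 hcd)
  have hvol : 0 < (volume (Icc a b ×ˢ Icc c d)).toReal := by
    rw [Measure.volume_eq_prod, Measure.prod_prod, Real.volume_Icc, Real.volume_Icc,
      ENNReal.toReal_mul, ENNReal.toReal_ofReal (by linarith), ENNReal.toReal_ofReal (by linarith)]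
    exact mul_pos (by linarith) (by linarith)
  refine ⟨⟨(hint.mono interior_subset).image _, hcov.isBounded, ?_⟩,
    le_antisymm (hcov.dimH_le hL.le) (two_le_dimH_graphOver hint F)⟩
  have hsmall : ∀ᶠ δ : ℝ in 𝓝[>] 0, δ ∈ Ioc 0 L := Ioc_mem_nhdsGT hL
  refine tendsto_log_div_of_le_of_le (div_pos hvol (by norm_num : (0 : ℝ) < 4))
    (K₂ := 4 * C * L ^ 2) (by positivity) ?_ ?_
  · filter_upwards [hsmall] with δ hδ
    obtain ⟨k, -, hU⟩ := hcov.exists_cover hC.le hL hδ.1 hδ.2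
    rw [div_div]
    exact le_coverNumber_graphOver hδ.1 ⟨k, hU⟩
  · filter_upwards [hsmall] with δ hδ
    exact hcov.coverNumber_le hC.le hL hδ.1 hδ.2

end BivariateVariation

theorem mainTheorem3 (a b c d : ℝ) (hab : a < b) (hcd : c < d)
    (α β : ℝ) (hα : 0 < α) (hβ : 0 < β) (f : ℝ × ℝ → ℝ)
    (hcont : ContinuousOn f (Icc a b ×ˢ Icc c d))
    (hbv : BivariateVariation.ArzelaBV a b c d f) :
    BivariateVariation.HasBoxDim
        (BivariateVariation.graphOver (Icc a b ×ˢ Icc c d)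
          (BivariateVariation.fractionalIntegral a c α β f)) 2 ∧
      dimH (BivariateVariation.graphOver (Icc a b ×ˢ Icc c d)
          (BivariateVariation.fractionalIntegral a c α β f)) = 2 := by
  obtain ⟨F, M, hF, heq⟩ :=
    BivariateVariation.exists_chainVariationLE_eqOn_fractionalIntegral hab.le hcd.le hα hβ hcont hbv
  have hgraph : BivariateVariation.graphOver (Icc a b ×ˢ Icc c d)
      (BivariateVariation.fractionalIntegral a c α β f) =
        BivariateVariation.graphOver (Icc a b ×ˢ Icc c d) F :=
    image_congr fun p hp => by rw [heq hp]
  rw [hgraph]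
  exact hF.hasBoxDim_graphOver_and_dimH hab hcd
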